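/- Call an entire function a local homeomorphism if its derivative has no zero; let ${\rm elh}(\mathbb{C})$ be the set of entire local homeomorphisms $f$ with $f'(0)=1$, and let ${\rm Aut}(\mathbb{C})=\{z+a : a\in\mathbb{C}\}$ be the set of automorphisms of $\mathbb{C}$ with this normalization. An entire local homeomorphism is called prime if it is not of the form $g\circ h$ with entire functions $g,h$ neither of which is an affine map $z\mapsto \alpha z+\beta$ ($\alpha\neq 0$). Theorem. Let $p\in\mathbb{C}[t]$ be a non-constant polynomial and let $f(z)=\int_0^z e^{p(t)}\,dt$. (1) $f$ is an entire local homeomorphism and is not affine. In particular, if $f$ is normalized by $f'(0)=e^{p(0)}=1$, then $f\in{\rm elh}(\mathbb{C})\setminus{\rm Aut}(\mathbb{C})$. (2) $f$ is prime if and only if $f(\mathbb{C})=\mathbb{C}$. (3) Suppose that $f$ omits the value $d\in\mathbb{C}$. Then for every integer $N\ge 1$ and every $a\in\mathbb{C}$ there is a non-affine entire local homeomorphism $L$ with $L(\mathbb{C})=\mathbb{C}\setminus\{a\}$ and $$f(z)=d+\frac{1}{N+1}\,(L(z)-a)^{N+1}\qquad(z\in\mathbb{C}),$$ that is, $L=a+(N+1)^{1/(N+1)}(f-d)^{1/(N+1)}$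 for an entire branch of the root. Moreover, there are a constant $\omega\in\mathbb{C}\setminus\{0\}$ and a function $L\in{\rm elh}(\mathbb{C})\setminus{\rm Aut}(\mathbb{C})$ with $L(\mathbb{C})=\mathbb{C}\setminus\{a\}$ such that $f(z)=d+\frac{\omega}{N+1}\,(L(z)-a)^{N+1}$ for all $z\in\mathbb{C}$. -/

import Mathlib

/-- Entire functions of one complex variable whose derivative has no zero
(no normalization at the origin). -/
def IsEntireLocalHomeo (f : ℂ → ℂ) : Prop :=
  Differentiable ℂ f ∧ ∀ z, deriv f z ≠ 0

/-- The class `elh(ℂ)`: entire functions with non-vanishing derivative, normalized by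
`f'(0) = 1`. -/
def elh : Set (ℂ → ℂ) :=
  {f | IsEntireLocalHomeo f ∧ deriv f 0 = 1}

/-- The normalized holomorphic automorphisms `z ↦ z + a` of `ℂ`. -/
def autC : Set (ℂ → ℂ) :=
  {f | ∃ a : ℂ, f = fun z => z + a}

/-- All holomorphic automorphisms `z ↦ a z + b`, `a ≠ 0`, of `ℂ`. -/
def affineAut : Set (ℂ → ℂ) :=
  {f | ∃ a b : ℂ, a ≠ 0 ∧ f = fun z => a * z + b}

/-- `c` is a composition of two entire functions neither of which is an automorphism of `ℂ`.
The factors are arbitrary entire functions; their derivatives may vanish. -/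
def IsCompositeEntire (c : ℂ → ℂ) : Prop :=
  ∃ g h : ℂ → ℂ, Differentiable ℂ g ∧ Differentiable ℂ h ∧
    g ∉ affineAut ∧ h ∉ affineAut ∧ c = g ∘ h

/-- A prime function: an entire function with non-vanishing derivative that is not composite. -/
def IsPrimeEntire (f : ℂ → ℂ) : Prop :=
  IsEntireLocalHomeo f ∧ ¬ IsCompositeEntire f

/-- `f(z) = ∫₀ᶻ exp (p(t)) dt`, the integral being taken along the segment from `0` to `z`. -/
noncomputable def expIntegral (p : Polynomial ℂ) (z : ℂ) : ℂ :=
  ∫ s in (0 : ℝ)..1, Complex.exp (p.eval ((s : ℂ) * z)) * z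

/-! The function `f` has finite order, and everything rests on rigidity of such functions. If a
critical-point-free function of finite order omits `b`, its difference with `b` is `exp q` with `q`
a polynomial (`exists_polynomial_log`), and absence of critical points makes `q` affine. So an
omitted value gives `f = d + exp (γ z + β)`, which factors through every power.

Conversely let `f = g ∘ h` be onto. A Pólya-type bound (`norm_le_of_comp_norm_le`) gives `h` finite
order. If `h` is onto, `g' = exp G` and `h' = exp q`, so `G ∘ h` differs from `p - q` by a constant;
the same bound makes `h` a polynomial without critical points, hence affine, unless `G` is constant
and `g` affine. If `h` omits a value, it is a translated exponential, so `f` is periodic, `p` is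
affine, and `f` omits a value after all. -/

/-! ### Entire functions: polynomial growth, logarithms, finite order -/

theorem differentiable_dslope {f : ℂ → ℂ} (hf : Differentiable ℂ f) (c : ℂ) :
    Differentiable ℂ (dslope f c) :=
  differentiableOn_univ.1 ((Complex.differentiableOn_dslope (s := Set.univ) (c := c)
    Filter.univ_mem).2 hf.differentiableOn)

open Polynomial in
-- Passing to `dslope f 0` lowers the growth exponent by one; Liouville's theorem is the base case.
theorem exists_polynomial_of_norm_le {f : ℂ → ℂ} (hf : Differentiable ℂ f) {C : ℝ} {m : ℕ}
    (h : ∀ z, ‖f z‖ ≤ C * (1 + ‖z‖) ^ m) : ∃ P : ℂ[X], ∀ z, f z = P.eval z := by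
  induction m generalizing f C with
  | zero =>
    obtain ⟨c, hc⟩ := hf.exists_const_forall_eq_of_bounded
      (isBounded_iff_forall_norm_le.2 ⟨C, by rintro _ ⟨z, rfl⟩; simpa using h z⟩)
    exact ⟨Polynomial.C c, fun z => by simp [hc]⟩
  | succ m ih =>
    have hC : 0 ≤ C := by simpa using (norm_nonneg _).trans (h 0)
    have hg := differentiable_dslope hf 0
    obtain ⟨B, hB⟩ := (isCompact_closedBall (0 : ℂ) 1).exists_bound_of_continuousOn
      hg.continuous.continuousOn
    have hB0 : 0 ≤ B := (norm_nonneg _).trans (hB 0 (by simp))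
    obtain ⟨P, hP⟩ := ih hg (C := B + 4 * C) (fun z => by
      have h1 : 1 ≤ (1 + ‖z‖) ^ m := one_le_pow₀ (by linarith [norm_nonneg z])
      rcases le_or_gt ‖z‖ 1 with hz | hz
      · have := hB z (by simpa using hz)
        nlinarith
      · have hz0 : z ≠ 0 := by rintro rfl; simp at hz; linarith
        rw [dslope_of_ne _ hz0, slope_def_field, norm_div, sub_zero, div_le_iff₀ (by linarith)]
        have e1 : ‖f z - f 0‖ ≤ C * (1 + ‖z‖) ^ (m + 1) + C :=
          (norm_sub_le _ _).trans (add_le_add (h z) (by simpa using h 0))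
        have e2 : C ≤ C * (1 + ‖z‖) ^ (m + 1) :=
          le_mul_of_one_le_right hC (one_le_pow₀ (by linarith [norm_nonneg z]))
        calc ‖f z - f 0‖ ≤ 2 * (C * (1 + ‖z‖) ^ (m + 1)) := by linarith
          _ = 2 * (C * (1 + ‖z‖) ^ m) * (1 + ‖z‖) := by ring
          _ ≤ 2 * (C * (1 + ‖z‖) ^ m) * (2 * ‖z‖) := by gcongr; linarith
          _ = (4 * C) * (1 + ‖z‖) ^ m * ‖z‖ := by ring
          _ ≤ (B + 4 * C) * (1 + ‖z‖) ^ m * ‖z‖ := by gcongr; linarith)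
    refine ⟨Polynomial.C (f 0) + X * P, fun z => ?_⟩
    have := sub_smul_dslope f 0 z
    simp only [sub_zero, smul_eq_mul] at this
    simp [← hP, this]

/-- A logarithm, normalised at the centre, of a zero-free holomorphic function on a disc. -/
theorem exists_log_on_ball {u : ℂ → ℂ} {r : ℝ} (hr : 0 < r)
    (hu : DifferentiableOn ℂ u (Metric.ball 0 r)) (h0 : ∀ z ∈ Metric.ball 0 r, u z ≠ 0) :
    ∃ l : ℂ → ℂ, (∀ z ∈ Metric.ball 0 r, HasDerivAt l (deriv u z / u z) z) ∧ l 0 = 0 ∧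
      ∀ z ∈ Metric.ball 0 r, u z = u 0 * Complex.exp (l z) := by
  have hd : DifferentiableOn ℂ (fun z => deriv u z / u z) (Metric.ball 0 r) :=
    (hu.deriv Metric.isOpen_ball).div hu h0
  obtain ⟨l₀, hl₀⟩ := hd.isExactOn_ball
  have hl : ∀ z ∈ Metric.ball 0 r, HasDerivAt (fun z => l₀ z - l₀ 0) (deriv u z / u z) z :=
    fun z hz => (hl₀ z hz).sub_const _
  refine ⟨fun z => l₀ z - l₀ 0, hl, by simp, fun z hz => ?_⟩
  have hder : ∀ w ∈ Metric.ball (0 : ℂ) r,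
      HasDerivAt (fun z => u z * Complex.exp (-(l₀ z - l₀ 0))) 0 w := fun w hw => by
    have h1 := ((hu w hw).differentiableAt (Metric.isOpen_ball.mem_nhds hw)).hasDerivAt
    refine (h1.mul (hl w hw).neg.cexp).congr_deriv ?_
    have := h0 w hw
    field_simp
    ring
  have := (convex_ball (0 : ℂ) r).is_const_of_fderivWithin_eq_zero (𝕜 := ℂ)
    (f := fun z => u z * Complex.exp (-(l₀ z - l₀ 0)))
    (fun w hw => (hder w hw).differentiableAt.differentiableWithinAt)
    (fun w hw => by
      rw [fderivWithin_of_isOpen Metric.isOpen_ball hw, (hder w hw).hasFDerivAt.fderiv]; ext; simp)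
    hz (Metric.mem_ball_self hr)
  simp only [sub_self, neg_zero, Complex.exp_zero, mul_one, Complex.exp_neg] at this
  rw [← this]
  field_simp [Complex.exp_ne_zero]

theorem exists_log_of_entire {u : ℂ → ℂ} (hu : Differentiable ℂ u) (h0 : ∀ z, u z ≠ 0) :
    ∃ k : ℂ → ℂ, Differentiable ℂ k ∧ ∀ z, u z = Complex.exp (k z) := by
  have hd : Differentiable ℂ (fun z => deriv u z / u z) := hu.deriv.div hu h0
  obtain ⟨l, hl⟩ := hd.isExactOn_univ
  have hl : ∀ z, HasDerivAt l (deriv u z / u z) z := fun z => hl z trivial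
  have hder : ∀ w, HasDerivAt (fun z => u z * Complex.exp (-l z)) 0 w := fun w => by
    refine ((hu w).hasDerivAt.mul (hl w).neg.cexp).congr_deriv ?_
    have := h0 w
    field_simp
    ring
  have hc := is_const_of_deriv_eq_zero (fun w => (hder w).differentiableAt)
    (fun w => (hder w).deriv)
  refine ⟨fun z => l z + Complex.log (u 0 * Complex.exp (-l 0)), fun z =>
    (hl z).differentiableAt.add_const _, fun z => ?_⟩
  have h1 : u 0 * Complex.exp (-l 0) ≠ 0 := mul_ne_zero (h0 0) (Complex.exp_ne_zero _)
  rw [Complex.exp_add, Complex.exp_log h1, ← hc z 0, Complex.exp_neg]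
  field_simp [Complex.exp_ne_zero]

theorem eq_const_of_exp_eq_one {F : ℂ → ℂ} (hF : Differentiable ℂ F)
    (h : ∀ z, Complex.exp (F z) = 1) : ∀ z, F z = F 0 := fun z => by
  refine is_const_of_deriv_eq_zero hF (fun w => ?_) z 0
  have h1 : HasDerivAt (fun z => Complex.exp (F z)) (Complex.exp (F w) * deriv F w) w :=
    (hF w).hasDerivAt.cexp
  have h2 : (fun z => Complex.exp (F z)) = fun _ => 1 := funext h
  rw [h2, h] at h1
  simpa using h1.unique (hasDerivAt_const w (1 : ℂ))

theorem norm_le_of_re_le {k : ℂ → ℂ} (hk : Differentiable ℂ k) {C : ℝ} {m : ℕ}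
    (h : ∀ z, (k z).re ≤ C * (1 + ‖z‖) ^ m) :
    ∃ C', ∀ z, ‖k z‖ ≤ C' * (1 + ‖z‖) ^ m := by
  refine ⟨2 * ((|C| + 1) * 2 ^ m) + 3 * ‖k 0‖, fun z => ?_⟩
  have hz := norm_nonneg z
  have h1 : 1 ≤ (1 + ‖z‖) ^ m := one_le_pow₀ (by linarith)
  -- With `R = 2‖z‖ + 1`, `R - ‖z‖ = ‖z‖ + 1`, so the two Borel–Carathéodory quotients are at most 2
  -- and 3. Using `|C| + 1` keeps the bound positive.
  have hb := Complex.borelCaratheodory (f := k) (z := z) (R := 2 * ‖z‖ + 1)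
    (M := (|C| + 1) * (2 * (1 + ‖z‖)) ^ m)
    (by positivity) hk.differentiableOn (fun w hw => by
      have hw : ‖w‖ < 2 * ‖z‖ + 1 := by simpa using hw
      refine (h w).trans ?_
      have : C ≤ |C| + 1 := by linarith [le_abs_self C]
      gcongr
      linarith) (by linarith) (by simp; linarith)
  refine hb.trans ?_
  rw [← add_div, div_le_iff₀ (by linarith), mul_pow]
  have h2 : 0 ≤ (|C| + 1) * 2 ^ m := by positivity
  set D := (|C| + 1) * 2 ^ m
  set W := (1 + ‖z‖) ^ m
  have e1 : 2 * ((|C| + 1) * (2 ^ m * W)) = 2 * (D * W) := by simp only [D]; ring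
  rw [e1]
  have e2 : 0 ≤ D * W := by positivity
  have e3 : ‖k 0‖ ≤ ‖k 0‖ * W := le_mul_of_one_le_right (norm_nonneg _) h1
  have e4 : 0 ≤ ‖k 0‖ := norm_nonneg _
  nlinarith [mul_nonneg e2 hz, mul_nonneg (sub_nonneg.2 e3) hz, mul_nonneg e4 hz]

open Polynomial in
/-- A zero-free entire function of finite order is the exponential of a polynomial. -/
theorem exists_polynomial_log {u : ℂ → ℂ} (hu : Differentiable ℂ u) (h0 : ∀ z, u z ≠ 0) {C : ℝ}
    {m : ℕ} (h : ∀ z, ‖u z‖ ≤ Real.exp (C * (1 + ‖z‖) ^ m)) :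
    ∃ q : ℂ[X], ∀ z, u z = Complex.exp (q.eval z) := by
  obtain ⟨k, hk, huk⟩ := exists_log_of_entire hu h0
  obtain ⟨C', hC'⟩ := norm_le_of_re_le hk (C := C) (m := m) (fun z => by
    have := h z
    rwa [huk, Complex.norm_exp, Real.exp_le_exp] at this)
  obtain ⟨q, hq⟩ := exists_polynomial_of_norm_le hk hC'
  exact ⟨q, fun z => by rw [huk, hq]⟩

open Polynomial in
theorem exists_norm_eval_le (p : ℂ[X]) :
    ∃ (C : ℝ) (m : ℕ), 0 ≤ C ∧ ∀ z, ‖p.eval z‖ ≤ C * (1 + ‖z‖) ^ m := by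
  induction p using Polynomial.induction_on' with
  | add p q hp hq =>
    obtain ⟨C, m, hC, h⟩ := hp
    obtain ⟨D, n, hD, h'⟩ := hq
    refine ⟨C + D, m + n, by positivity, fun z => ?_⟩
    have hz : 1 ≤ 1 + ‖z‖ := by linarith [norm_nonneg z]
    rw [eval_add, add_mul]
    refine (norm_add_le _ _).trans (add_le_add ((h z).trans ?_) ((h' z).trans ?_))
    · exact mul_le_mul_of_nonneg_left (pow_le_pow_right₀ hz (by omega)) hC
    · exact mul_le_mul_of_nonneg_left (pow_le_pow_right₀ hz (by omega)) hD
  | monomial n a =>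
    refine ⟨‖a‖, n, norm_nonneg _, fun z => ?_⟩
    rw [eval_monomial, norm_mul, norm_pow]
    gcongr
    linarith

open Polynomial in
theorem eq_C_of_eval_ne_zero {p : ℂ[X]} (h : ∀ z, p.eval z ≠ 0) : ∃ c, c ≠ 0 ∧ p = C c := by
  have hd : ¬ 0 < p.degree := fun hd => by
    obtain ⟨z, hz⟩ := Complex.exists_root hd
    exact h z hz
  have := eq_C_of_degree_le_zero (not_lt.1 hd)
  refine ⟨p.coeff 0, fun h0 => h 0 ?_, this⟩
  rw [this, h0]; simp

theorem eq_affine_of_deriv_eq {h : ℂ → ℂ} (hh : Differentiable ℂ h) {c : ℂ}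
    (hc : ∀ z, deriv h z = c) : ∀ z, h z = c * z + h 0 := fun z => by
  have hd : ∀ w, HasDerivAt (fun z => h z - c * z) 0 w := fun w => by
    refine ((hh w).hasDerivAt.sub ((hasDerivAt_id w).const_mul c)).congr_deriv ?_
    simp [hc]
  have := is_const_of_deriv_eq_zero (fun w => (hd w).differentiableAt) (fun w => (hd w).deriv) z 0
  simp only [mul_zero, sub_zero] at this
  rw [← this]; ring

theorem mem_affineAut_of_deriv_eq {h : ℂ → ℂ} (hh : Differentiable ℂ h) {c : ℂ} (h0 : c ≠ 0)
    (hc : ∀ z, deriv h z = c) : h ∈ affineAut :=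
  ⟨c, h 0, h0, funext (eq_affine_of_deriv_eq hh hc)⟩

open Polynomial in
theorem eval_eq_of_derivative_eval_ne_zero {p : ℂ[X]} (h : ∀ z, p.derivative.eval z ≠ 0) :
    ∃ a b : ℂ, a ≠ 0 ∧ ∀ z, p.eval z = a * z + b := by
  obtain ⟨c, hc, hp⟩ := eq_C_of_eval_ne_zero h
  exact ⟨c, p.eval 0, hc, eq_affine_of_deriv_eq p.differentiable fun z => by simp [hp]⟩

/-! ### Growth of the inner factor of a composition -/

/-- If `‖g ∘ h‖ ≤ M < ‖g a‖` on a disc, then `h` maps no curve joining two points with the same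
image to a loop around `a`: the logarithm of `h - a` is a function of `h`. -/
theorem log_eq_of_eq {g h l : ℂ → ℂ} (hg : Differentiable ℂ g) (hh : Differentiable ℂ h)
    {r M : ℝ} {a : ℂ} (hM : ∀ z ∈ Metric.ball (0 : ℂ) r, ‖g (h z)‖ ≤ M) (ha : M < ‖g a‖)
    (hl : ∀ z ∈ Metric.ball 0 r, HasDerivAt l (deriv h z / (h z - a)) z)
    {z w : ℂ} (hz : z ∈ Metric.ball 0 r) (hw : w ∈ Metric.ball 0 r) (hzw : h z = h w) :
    l z = l w := by
  have hM0 : 0 ≤ M := (norm_nonneg _).trans (hM z hz)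
  have hga : g a ≠ 0 := fun h0 => by rw [h0, norm_zero] at ha; linarith
  have hsub : segment ℝ z w ⊆ Metric.ball (0 : ℂ) r := (convex_ball _ _).segment_subset hz hw
  have hne : ∀ x ∈ Metric.ball (0 : ℂ) r, h x - a ≠ 0 := fun x hx h0 => by
    have := hM x hx
    rw [sub_eq_zero.1 h0] at this
    linarith
  have hcomp : IsCompact (segment ℝ z w) := by
    rw [← convexHull_pair (𝕜 := ℝ)]
    exact (Set.toFinite {z, w}).isCompact_convexHull ℝ
  obtain ⟨K, hK⟩ := hcomp.exists_bound_of_continuousOn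
    (f := fun x => deriv h x / (h x - a))
    ((hh.deriv.continuous.continuousOn).div (hh.continuous.sub continuous_const).continuousOn
      fun x hx => hne x (hsub hx))
  -- Since `(g ^ N - g a ^ N) / (w - a)` has an entire primitive `R`, adding `R ∘ h / g a ^ N` to
  -- `l` multiplies the derivative by the small factor `(g ∘ h / g a) ^ N`. The added term takes
  -- equal values at `z` and `w`.
  have key : ∀ N : ℕ, ‖l w - l z‖ ≤ (M / ‖g a‖) ^ N * K * ‖w - z‖ := fun N => by
    obtain ⟨R, hR⟩ := (differentiable_dslope (hg.pow N) a).isExactOn_univ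
    have hd : ∀ x ∈ Metric.ball (0 : ℂ) r, HasDerivAt (fun x => l x + R (h x) / g a ^ N)
        ((g (h x) / g a) ^ N * (deriv h x / (h x - a))) x := fun x hx => by
      refine ((hl x hx).add (((hR (h x) trivial).comp x (hh x).hasDerivAt).div_const _)).congr_deriv
        ?_
      have h1 := hne x hx
      rw [dslope_of_ne _ (sub_ne_zero.1 h1), slope_def_field]
      simp only [Pi.pow_apply, div_pow]
      field_simp
      ring
    have := (convex_segment (𝕜 := ℝ) z w).norm_image_sub_le_of_norm_hasDerivWithin_le
      (fun x hx => (hd x (hsub hx)).hasDerivWithinAt) (C := (M / ‖g a‖) ^ N * K)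
      (fun x hx => by
        rw [norm_mul, norm_pow, norm_div]
        gcongr
        · exact hM x (hsub hx)
        · exact hK x hx) (left_mem_segment ℝ z w) (right_mem_segment ℝ z w)
    simpa [hzw] using this
  have hlim : Filter.Tendsto (fun N : ℕ => (M / ‖g a‖) ^ N * K * ‖w - z‖) Filter.atTop
      (nhds (0 * K * ‖w - z‖)) :=
    ((tendsto_pow_atTop_nhds_zero_of_lt_one (by positivity)
      ((div_lt_one (by linarith)).2 ha)).mul_const _).mul_const _
  have h0 : ‖l w - l z‖ ≤ 0 := by
    simpa using ge_of_tendsto' hlim key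
  exact (sub_eq_zero.1 (norm_le_zero_iff.1 h0)).symm

/-- A nonconstant entire function grows at least linearly on circles. -/
theorem exists_norm_eq_and_lt_norm {g : ℂ → ℂ} (hg : Differentiable ℂ g) {w₁ : ℂ}
    (hw : g w₁ ≠ g 0) : ∃ K₀ : ℝ, 0 < K₀ ∧ ∀ K, K₀ ≤ K → ∀ M, 0 ≤ M →
      ∃ a : ℂ, ‖a‖ = K * (1 + M) ∧ M < ‖g a‖ := by
  have hw0 : w₁ ≠ 0 := by rintro rfl; exact hw rfl
  set c := ‖dslope g 0 w₁‖ with hc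
  have hc0 : 0 < c := by
    rw [hc, dslope_of_ne _ hw0, slope_def_field, norm_pos_iff]
    exact div_ne_zero (sub_ne_zero.2 hw) (by simpa using hw0)
  refine ⟨‖w₁‖ + (2 + ‖g 0‖) / c, by positivity, fun K hK M hM => ?_⟩
  have hK1 : ‖w₁‖ ≤ K := by
    have : 0 ≤ (2 + ‖g 0‖) / c := by positivity
    linarith
  have hK2 : 2 + ‖g 0‖ ≤ K * c := by
    rw [← div_le_iff₀ hc0]
    linarith [norm_nonneg w₁]
  have hK0 : 0 < K := (norm_pos_iff.2 hw0).trans_le hK1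
  set ρ := K * (1 + M) with hρ
  have hρK : K ≤ ρ := by nlinarith
  have hρ0 : 0 < ρ := by linarith
  -- Otherwise the maximum principle for `dslope g 0` on the disc of radius `ρ` gives `c * ρ ≤ M +
  -- ‖g 0‖`, against the choice of `K₀`.
  by_contra! hcon
  have hbd : ∀ z ∈ frontier (Metric.ball (0 : ℂ) ρ), ‖dslope g 0 z‖ ≤ (M + ‖g 0‖) / ρ := by
    intro z hz
    rw [frontier_ball _ hρ0.ne'] at hz
    have hz : ‖z‖ = ρ := by simpa using hz
    have hz0 : z ≠ 0 := by rintro rfl; simp at hz; linarith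
    rw [dslope_of_ne _ hz0, slope_def_field, norm_div, sub_zero, hz]
    gcongr
    exact (norm_sub_le _ _).trans (by linarith [hcon z hz])
  have := Complex.norm_le_of_forall_mem_frontier_norm_le Metric.isBounded_ball
    (differentiable_dslope hg 0).diffContOnCl hbd (z := w₁) (by
      rw [closure_ball _ hρ0.ne']; simpa using hK1.trans hρK)
  rw [← hc, le_div_iff₀ hρ0] at this
  nlinarith [norm_nonneg (g 0)]

/-- Harnack's inequality for the logarithm of a holomorphic function bounded away from zero. -/
theorem norm_le_of_le_norm {u : ℂ → ℂ} {r δ : ℝ} (hr : 0 < r) (hδ : 0 < δ)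
    (hu : DifferentiableOn ℂ u (Metric.ball 0 r)) (h0 : δ < ‖u 0‖)
    (h : ∀ z ∈ Metric.ball 0 r, δ ≤ ‖u z‖) {z : ℂ} (hz : ‖z‖ ≤ r / 2) :
    ‖u z‖ ≤ ‖u 0‖ ^ 3 / δ ^ 2 := by
  have hu0 : 0 < ‖u 0‖ := hδ.trans h0
  obtain ⟨l, hl, hl0, hul⟩ := exists_log_on_ball hr hu
    (fun w hw hw0 => by have := h w hw; rw [hw0, norm_zero] at this; linarith)
  have hΛ : 0 < Real.log (‖u 0‖ / δ) := Real.log_pos ((one_lt_div hδ).2 h0)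
  have hzb : z ∈ Metric.ball (0 : ℂ) r := by simp; linarith
  have hbc := Complex.borelCaratheodory_zero (f := fun w => -l w) hΛ
    (fun w hw => (hl w hw).differentiableAt.differentiableWithinAt.neg)
    (fun w hw => by
      have h1 := h w hw
      rw [hul w hw, norm_mul, Complex.norm_exp] at h1
      change (-l w).re ≤ _
      rw [Real.le_log_iff_exp_le (by positivity), Complex.neg_re, Real.exp_neg,
        inv_le_comm₀ (Real.exp_pos _) (by positivity), inv_div, div_le_iff₀ hu0]
      linarith) hr hzb (by simp [hl0])
  have h2 : ‖l z‖ ≤ 2 * Real.log (‖u 0‖ / δ) := by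
    rw [norm_neg] at hbc
    refine hbc.trans ?_
    rw [div_le_iff₀ (by linarith)]
    nlinarith
  rw [hul z hzb, norm_mul, Complex.norm_exp]
  calc ‖u 0‖ * Real.exp (l z).re ≤ ‖u 0‖ * Real.exp (2 * Real.log (‖u 0‖ / δ)) := by
        gcongr
        exact (Complex.re_le_norm _).trans h2
    _ = ‖u 0‖ ^ 3 / δ ^ 2 := by
        rw [two_mul, Real.exp_add, Real.exp_log (by positivity)]
        field_simp

/-- A polynomial form of Pólya's inequality: the inner factor of a composition of entire functions
is bounded by a power of a bound of the composition on a larger disc. -/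
theorem norm_le_of_comp_norm_le {g h : ℂ → ℂ} (hg : Differentiable ℂ g) (hh : Differentiable ℂ h)
    (hgc : ¬ ∀ w, g w = g 0) (hhc : ¬ ∀ z, h z = h 0) :
    ∃ C : ℝ, 0 ≤ C ∧ ∀ (z : ℂ) (M : ℝ), (∀ w : ℂ, ‖w‖ ≤ 2 * ‖z‖ + 2 → ‖g (h w)‖ ≤ M) →
      ‖h z‖ ≤ C * (1 + M) ^ 5 := by
  obtain ⟨w₁, hw₁⟩ := not_forall.1 hgc
  obtain ⟨K₀, hK₀, hK⟩ := exists_norm_eq_and_lt_norm hg hw₁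
  obtain ⟨η₀, hη₀, hηball⟩ : ∃ η > 0, Metric.ball (h 0) η ⊆ h '' Metric.ball 0 1 := by
    rcases hh.differentiableOn.analyticOnNhd isOpen_univ |>.is_constant_or_isOpenMap with hc | ho
    · obtain ⟨w, hw⟩ := hc
      exact absurd (fun z => by rw [hw, hw]) hhc
    · exact Metric.isOpen_iff.1 (ho _ Metric.isOpen_ball) _
        (Set.mem_image_of_mem _ (Metric.mem_ball_self one_pos))
  obtain ⟨η, hη, hη1, hηη⟩ : ∃ η : ℝ, 0 < η ∧ η ≤ 1 ∧ η ≤ η₀ :=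
    ⟨min 1 η₀, by positivity, min_le_left _ _, min_le_right _ _⟩
  obtain ⟨B₁, hB₁⟩ := (isCompact_closedBall (0 : ℂ) 1).exists_bound_of_continuousOn
    hh.continuous.continuousOn
  obtain ⟨B₂, hB₂⟩ := (isCompact_closedBall (0 : ℂ) 1).exists_bound_of_continuousOn
    hh.deriv.continuous.continuousOn
  have hB₁0 : 0 ≤ B₁ := (norm_nonneg _).trans (hB₁ 0 (by simp))
  have hB₂0 : 0 ≤ B₂ := (norm_nonneg _).trans (hB₂ 0 (by simp))
  -- `K₀` supplies the point `a`; `B₁ + 2 * B₂` makes `‖h' / (h - a)‖ ≤ 1 / 2` on the unit disc.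
  set K := K₀ + B₁ + 2 * B₂ + 1 with hKdef
  refine ⟨K + 2 * K * (9 * (6 * K / η) ^ 2) ^ 2, by positivity, fun z M hM => ?_⟩
  have hM0 : 0 ≤ M := (norm_nonneg _).trans (hM z (by linarith [norm_nonneg z]))
  obtain ⟨a, ha, hga⟩ := hK K (by linarith) M hM0
  set A := K * (1 + M) with hA
  have hAK : K ≤ A := by nlinarith
  have hA1 : 1 ≤ A := by linarith
  set r := 2 * ‖z‖ + 2 with hr
  have hr0 : 0 < r := by positivity
  have hMr : ∀ w ∈ Metric.ball (0 : ℂ) r, ‖g (h w)‖ ≤ M := fun w hw =>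
    hM w (by simpa using (mem_ball_zero_iff.1 hw).le)
  have hne : ∀ w ∈ Metric.ball (0 : ℂ) r, h w - a ≠ 0 := fun w hw h0 => by
    have := hMr w hw
    rw [sub_eq_zero.1 h0] at this
    linarith
  obtain ⟨l, hl, hl0, hul⟩ := exists_log_on_ball hr0 (hh.sub_const a).differentiableOn hne
  simp only [deriv_sub_const] at hl
  have hsub : Metric.ball (0 : ℂ) 1 ⊆ Metric.ball 0 r :=
    Metric.ball_subset_ball (by linarith [norm_nonneg z])
  have hl1 : ∀ w ∈ Metric.ball (0 : ℂ) 1, ‖l w‖ ≤ 1 / 2 := fun w hw => by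
    have hbd := (convex_ball (0 : ℂ) 1).norm_image_sub_le_of_norm_hasDerivWithin_le (C := 1 / 2)
      (fun x hx => (hl x (hsub hx)).hasDerivWithinAt) (fun x hx => by
        have hx' := Metric.ball_subset_closedBall hx
        have h1 : A - B₁ ≤ ‖h x - a‖ := by
          have := norm_sub_norm_le a (h x)
          rw [norm_sub_rev] at this
          linarith [hB₁ x hx']
        rw [norm_div, div_le_iff₀ (by linarith)]
        linarith [hB₂ x hx']) (Metric.mem_ball_self one_pos) hw
    rw [hl0, sub_zero, sub_zero] at hbd
    have := mem_ball_zero_iff.1 hw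
    linarith
  -- The square root of `(h - a) / (h 0 - a)` with value 1 at 0.
  set s : ℂ → ℂ := fun w => Complex.exp (l w / 2) with hs
  have hs2 : ∀ w ∈ Metric.ball (0 : ℂ) r, h w - a = (h 0 - a) * s w ^ 2 := fun w hw => by
    rw [hul w hw, hs, ← Complex.exp_nat_mul]
    congr 2
    push_cast
    ring
  have hs1 : ∀ w ∈ Metric.ball (0 : ℂ) 1, 1 < ‖s w + 1‖ := fun w hw => by
    have h1 : ‖l w / 2‖ ≤ 1 / 4 := by
      rw [norm_div, Complex.norm_two]
      linarith [hl1 w hw]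
    have h2 := Complex.norm_exp_sub_one_le (x := l w / 2) (by linarith)
    have h3 := norm_sub_norm_le (2 : ℂ) (1 - s w)
    rw [Complex.norm_two, norm_sub_rev 1, show (2 : ℂ) - (1 - s w) = s w + 1 by ring] at h3
    linarith
  have hh0a : ‖h 0 - a‖ ≤ 2 * A := by
    refine (norm_sub_le _ _).trans ?_
    linarith [hB₁ 0 (by simp)]
  have hA0 : 0 < A := by linarith
  set δ := η / (6 * A) with hδ
  have hδ0 : 0 < δ := by positivity
  have hδ1 : δ ≤ 1 := by
    rw [hδ, div_le_one (by positivity)]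
    linarith
  have hδA : 2 * A * (3 * δ) = η := by
    rw [hδ]; field_simp; norm_num
  -- If `s w` is near -1, then `h w` is near `h 0`, hence equal to `h w'` for some `w'` in the unit
  -- disc. Then `l w' = l w`, so `s w' = s w`, yet `s` stays near 1 on the unit disc.
  have hsδ : ∀ w ∈ Metric.ball (0 : ℂ) r, δ ≤ ‖s w + 1‖ := fun w hw => by
    by_contra! hlt
    have h1 : ‖s w - 1‖ ≤ 3 := by
      rw [show s w - 1 = (s w + 1) - 2 by ring]
      refine (norm_sub_le _ _).trans ?_
      rw [Complex.norm_two]; linarith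
    have h2 : ‖h w - h 0‖ < η := by
      rw [show h w - h 0 = (h 0 - a) * ((s w - 1) * (s w + 1)) by linear_combination hs2 w hw,
        norm_mul, norm_mul, ← hδA]
      calc _ ≤ 2 * A * (3 * ‖s w + 1‖) := by gcongr
        _ < _ := by gcongr
    obtain ⟨w', hw', hww'⟩ := hηball (show h w ∈ Metric.ball (h 0) η₀ by
      rw [mem_ball_iff_norm]; linarith)
    have h3 : l w' = l w := log_eq_of_eq hg hh hMr hga hl (hsub hw') hw hww'
    have h4 := hs1 w' hw'
    simp only [hs, h3] at h4
    simp only [hs] at hlt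
    linarith
  have hu0 : s 0 + 1 = 2 := by simp [hs, hl0]; norm_num
  have hfin := norm_le_of_le_norm (u := fun w => s w + 1) (z := z) hr0 hδ0
    (fun w hw => ((hl w hw).differentiableAt.div_const 2).cexp.add_const 1
      |>.differentiableWithinAt) (by simp only [hu0, Complex.norm_two]; linarith) hsδ
    (by rw [hr]; linarith)
  simp only [hu0, Complex.norm_two] at hfin
  have hinv : 1 ≤ 1 / δ ^ 2 := by
    rw [le_div_iff₀ (by positivity), one_mul]
    exact pow_le_one₀ hδ0.le hδ1
  have hsz : ‖s z‖ ≤ 9 * (1 / δ ^ 2) := by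
    have := norm_sub_le (s z + 1) 1
    rw [add_sub_cancel_right, norm_one] at this
    have e : (2 : ℝ) ^ 3 / δ ^ 2 = 8 * (1 / δ ^ 2) := by ring
    linarith
  have hzr : z ∈ Metric.ball (0 : ℂ) r := by
    simp; linarith [norm_nonneg z]
  have hδinv : 1 / δ ^ 2 = (6 * K / η) ^ 2 * (1 + M) ^ 2 := by
    rw [hδ, hA]; field_simp
  -- The exponent 5: one factor `1 + M` from `A`, four from the square of `1 / δ ^ 2`.
  have h5 : ‖h z‖ ≤ A + 2 * A * (9 * (1 / δ ^ 2)) ^ 2 := by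
    have : h z = a + (h 0 - a) * s z ^ 2 := by linear_combination hs2 z hzr
    rw [this]
    refine (norm_add_le _ _).trans ?_
    rw [ha, norm_mul, norm_pow]
    gcongr
  refine h5.trans ?_
  have hM1 : 1 ≤ 1 + M := by linarith
  have e1 : (1 + M) ≤ (1 + M) ^ 5 := le_self_pow₀ hM1 (by norm_num)

  have hK0 : 0 ≤ K := by positivity
  have hX : 0 ≤ 2 * K * (9 * (6 * K / η) ^ 2) ^ 2 := by positivity
  calc A + 2 * A * (9 * (1 / δ ^ 2)) ^ 2
      = K * (1 + M) + 2 * K * (9 * (6 * K / η) ^ 2) ^ 2 * (1 + M) ^ 5 := by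
        rw [hδinv, hA]; ring
    _ ≤ K * (1 + M) ^ 5 + 2 * K * (9 * (6 * K / η) ^ 2) ^ 2 * (1 + M) ^ 5 := by gcongr
    _ = _ := by ring

/-! ### The exponential integral and growth of its factors -/

open Polynomial in
theorem hasDerivAt_expIntegral (p : ℂ[X]) (z : ℂ) :
    HasDerivAt (expIntegral p) (Complex.exp (p.eval z)) z := by
  have hd : Differentiable ℂ (fun t => Complex.exp (p.eval t)) := p.differentiable.cexp
  obtain ⟨F, hF⟩ := hd.isExactOn_univ
  have hF : ∀ z, HasDerivAt F (Complex.exp (p.eval z)) z := fun z => hF z trivial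
  have heq : expIntegral p = fun z => F z - F 0 := by
    funext z
    have h1 : ∀ s ∈ Set.uIcc (0 : ℝ) 1, HasDerivAt (fun s : ℝ => F ((s : ℂ) * z))
        (Complex.exp (p.eval ((s : ℂ) * z)) * z) s := fun s _ => by
      have h2 : HasDerivAt (fun s : ℝ => (s : ℂ) * z) z s := by
        simpa using (Complex.ofRealCLM.hasDerivAt (x := s)).mul_const z
      exact (hF _).comp s h2
    have := intervalIntegral.integral_eq_sub_of_hasDerivAt h1
      (Continuous.intervalIntegrable (by
        have := hd.continuous
        have h3 : Continuous fun s : ℝ => (s : ℂ) * z := by fun_prop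
        exact (this.comp h3).mul continuous_const) _ _)
    simpa [expIntegral] using this
  rw [heq]
  exact (hF z).sub_const _

open Polynomial in
theorem exists_norm_expIntegral_le (p : ℂ[X]) : ∃ (C : ℝ) (m : ℕ), 0 ≤ C ∧
    ∀ z, ‖expIntegral p z‖ ≤ Real.exp (C * (1 + ‖z‖) ^ m) := by
  obtain ⟨C, m, hC, h⟩ := exists_norm_eval_le p
  -- The raised exponent absorbs the segment length, through `‖z‖ ≤ exp ‖z‖`.
  refine ⟨C + 1, m + 1, by positivity, fun z => ?_⟩
  have hz := norm_nonneg z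
  have h1 : ‖expIntegral p z‖ ≤ Real.exp (C * (1 + ‖z‖) ^ m) * ‖z‖ * |1 - 0| := by
    refine intervalIntegral.norm_integral_le_of_norm_le_const fun s hs => ?_
    rw [Set.uIoc_of_le zero_le_one] at hs
    rw [norm_mul, Complex.norm_exp]
    gcongr
    refine (Complex.re_le_norm _).trans ((h _).trans ?_)
    gcongr
    rw [norm_mul, Complex.norm_real, Real.norm_eq_abs, abs_of_pos hs.1]
    exact mul_le_of_le_one_left hz hs.2
  rw [sub_zero, abs_one, mul_one] at h1
  calc _ ≤ _ := h1
    _ ≤ Real.exp (C * (1 + ‖z‖) ^ m) * Real.exp ‖z‖ := by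
        gcongr
        linarith [Real.add_one_le_exp ‖z‖]
    _ = Real.exp (C * (1 + ‖z‖) ^ m + ‖z‖) := (Real.exp_add _ _).symm
    _ ≤ _ := by
        have e1 : 1 ≤ 1 + ‖z‖ := by linarith
        have e2 : (1 + ‖z‖) ^ m ≤ (1 + ‖z‖) ^ (m + 1) := pow_le_pow_right₀ e1 (by omega)
        have e3 : 1 + ‖z‖ ≤ (1 + ‖z‖) ^ (m + 1) := le_self_pow₀ e1 (by omega)
        rw [Real.exp_le_exp, add_mul]
        nlinarith

theorem comp_inner_norm_le_exp {g h : ℂ → ℂ} (hg : Differentiable ℂ g) (hh : Differentiable ℂ h)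
    (hgc : ¬ ∀ w, g w = g 0) (hhc : ¬ ∀ z, h z = h 0) {C : ℝ} {m : ℕ} (hC : 0 ≤ C)
    (hgh : ∀ z, ‖g (h z)‖ ≤ Real.exp (C * (1 + ‖z‖) ^ m)) :
    ∃ C', 0 ≤ C' ∧ ∀ z, ‖h z‖ ≤ Real.exp (C' * (1 + ‖z‖) ^ m) := by
  obtain ⟨D, hD, h1⟩ := norm_le_of_comp_norm_le hg hh hgc hhc
  -- On the larger disc `1 + ‖w‖ ≤ 3 * (1 + ‖z‖)`, whence `3 ^ m`; the 5 is the power in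
  -- `norm_le_of_comp_norm_le`.
  refine ⟨D + 5 * (1 + C * 3 ^ m), by positivity, fun z => ?_⟩
  have hz := norm_nonneg z
  set W := (1 + ‖z‖) ^ m with hW
  have hW1 : 1 ≤ W := one_le_pow₀ (by linarith)
  have h2 := h1 z (Real.exp (C * 3 ^ m * W)) (fun w hw => by
    refine (hgh w).trans ?_
    rw [Real.exp_le_exp, hW, mul_assoc, ← mul_pow]
    gcongr
    linarith)
  have h3 : 1 + Real.exp (C * 3 ^ m * W) ≤ Real.exp ((1 + C * 3 ^ m) * W) := by
    rw [add_mul, Real.exp_add, one_mul]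
    have e1 : 2 ≤ Real.exp W := by linarith [Real.add_one_le_exp W]
    have e2 : 1 ≤ Real.exp (C * 3 ^ m * W) := Real.one_le_exp (by positivity)
    nlinarith
  calc ‖h z‖ ≤ D * (1 + Real.exp (C * 3 ^ m * W)) ^ 5 := h2
    _ ≤ Real.exp (D * W) * Real.exp ((1 + C * 3 ^ m) * W) ^ 5 := by
        gcongr
        nlinarith [Real.add_one_le_exp (D * W)]
    _ = _ := by
        rw [← Real.exp_nat_mul, ← Real.exp_add]
        congr 1
        push_cast
        ring

theorem comp_inner_norm_le_pow {g h : ℂ → ℂ} (hg : Differentiable ℂ g) (hh : Differentiable ℂ h)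
    (hgc : ¬ ∀ w, g w = g 0) (hhc : ¬ ∀ z, h z = h 0) {C : ℝ} {m : ℕ} (hC : 0 ≤ C)
    (hgh : ∀ z, ‖g (h z)‖ ≤ C * (1 + ‖z‖) ^ m) :
    ∃ C' n, ∀ z, ‖h z‖ ≤ C' * (1 + ‖z‖) ^ n := by
  obtain ⟨D, hD, h1⟩ := norm_le_of_comp_norm_le hg hh hgc hhc
  refine ⟨D * (1 + C * 3 ^ m) ^ 5, m * 5, fun z => ?_⟩
  have hz := norm_nonneg z
  have hW1 : 1 ≤ (1 + ‖z‖) ^ m := one_le_pow₀ (by linarith)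
  refine (h1 z (C * 3 ^ m * (1 + ‖z‖) ^ m) (fun w hw => ?_)).trans ?_
  · refine (hgh w).trans ?_
    rw [mul_assoc, ← mul_pow]
    gcongr
    linarith
  · rw [pow_mul, mul_assoc D, ← mul_pow (1 + C * 3 ^ m)]
    refine mul_le_mul_of_nonneg_left (pow_le_pow_left₀ (by positivity) ?_ 5) hD
    rw [add_mul, one_mul]
    linarith

theorem norm_deriv_le_exp {h : ℂ → ℂ} (hh : Differentiable ℂ h) {C : ℝ} {m : ℕ} (hC : 0 ≤ C)
    (hb : ∀ z, ‖h z‖ ≤ Real.exp (C * (1 + ‖z‖) ^ m)) (z : ℂ) :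
    ‖deriv h z‖ ≤ Real.exp (C * 2 ^ m * (1 + ‖z‖) ^ m) := by
  have := Complex.norm_deriv_le_of_forall_mem_sphere_norm_le (c := z) one_pos hh.diffContOnCl
    (C := Real.exp (C * 2 ^ m * (1 + ‖z‖) ^ m)) (fun w hw => by
      refine (hb w).trans ?_
      rw [Real.exp_le_exp, mul_assoc, ← mul_pow]
      have h1 : ‖w - z‖ = 1 := by simpa using hw
      have h2 := norm_sub_norm_le w z
      gcongr
      linarith [norm_nonneg z])
  simpa using this

/-! ### Omitted values, periodicity and primeness -/

/-- An entire function of finite order without critical points that omits a value is an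
exponential. -/
theorem eq_add_exp_affine_of_omits {h : ℂ → ℂ} (hh : Differentiable ℂ h)
    (hd : ∀ z, deriv h z ≠ 0) {C : ℝ} {m : ℕ} (hC : 0 ≤ C)
    (hb : ∀ z, ‖h z‖ ≤ Real.exp (C * (1 + ‖z‖) ^ m)) {b : ℂ} (hob : ∀ z, h z ≠ b) :
    ∃ α β : ℂ, α ≠ 0 ∧ ∀ z, h z = b + Complex.exp (α * z + β) := by
  obtain ⟨q, hq⟩ := exists_polynomial_log (u := fun z => h z - b) (hh.sub_const b)
    (fun z => sub_ne_zero.2 (hob z)) (C := C + ‖b‖) (m := m) (fun z => by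
      have hW1 : 1 ≤ (1 + ‖z‖) ^ m := one_le_pow₀ (by linarith [norm_nonneg z])
      have hb0 := norm_nonneg b
      refine (norm_sub_le _ _).trans ((add_le_add_left (hb z) _).trans ?_)
      have e1 : 1 ≤ Real.exp (C * (1 + ‖z‖) ^ m) := Real.one_le_exp (by positivity)
      have e2 : 1 + ‖b‖ ≤ Real.exp (‖b‖ * (1 + ‖z‖) ^ m) := by
        have := Real.add_one_le_exp (‖b‖ * (1 + ‖z‖) ^ m)
        nlinarith
      rw [add_mul, Real.exp_add]
      nlinarith)
  have hq' : ∀ z, h z = b + Complex.exp (q.eval z) := fun z => by rw [← hq]; ring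
  obtain ⟨α, β, hα, hαβ⟩ := eval_eq_of_derivative_eval_ne_zero (p := q) (fun z h0 => hd z (by
    have h1 : HasDerivAt h (Complex.exp (q.eval z) * q.derivative.eval z) z := by
      rw [funext hq']
      exact ((q.hasDerivAt z).cexp.const_add b)
    rw [h1.deriv, h0, mul_zero]))
  exact ⟨α, β, hα, fun z => by rw [hq', hαβ]⟩

theorem exists_eq_exp_affine {α : ℂ} (hα : α ≠ 0) (β : ℂ) {w : ℂ} (hw : w ≠ 0) :
    ∃ z, Complex.exp (α * z + β) = w :=
  ⟨(Complex.log w - β) / α, by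
    rw [mul_div_cancel₀ _ hα, sub_add_cancel, Complex.exp_log hw]⟩

open Polynomial in
-- The difference `p (z + T) - p z` is constant, so `p'` is a periodic polynomial and therefore
-- constant.
theorem eval_eq_affine_of_exp_periodic {p : ℂ[X]} {T : ℂ} (hT : T ≠ 0)
    (h : ∀ z, Complex.exp (p.eval (z + T)) = Complex.exp (p.eval z)) :
    ∃ a b : ℂ, ∀ z, p.eval z = a * z + b := by
  have h1 := eq_const_of_exp_eq_one (F := fun z => p.eval (z + T) - p.eval z)
    ((p.differentiable.comp (differentiable_id.add_const T)).sub p.differentiable)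
    (fun z => by rw [Complex.exp_sub, h, div_self (Complex.exp_ne_zero _)])
  have h2 : ∀ z, p.derivative.eval (z + T) = p.derivative.eval z := fun z => by
    have e1 : HasDerivAt (fun z => p.eval (z + T) - p.eval z)
        (p.derivative.eval (z + T) - p.derivative.eval z) z :=
      ((p.hasDerivAt (z + T)).comp_add_const z T).sub (p.hasDerivAt z)
    rw [funext h1] at e1
    exact sub_eq_zero.1 (e1.unique (hasDerivAt_const _ _))
  have h3 : ∀ n : ℕ, p.derivative.eval (n * T) = p.derivative.eval 0 := fun n => by
    induction n with
    | zero => simp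
    | succ n ih => rw [← ih, ← h2 (n * T)]; push_cast; rw [add_mul, one_mul]
  have h4 : p.derivative - C (p.derivative.eval 0) = 0 :=
    eq_zero_of_infinite_isRoot _ (Set.infinite_of_injective_forall_mem (f := fun n : ℕ => (n : ℂ) * T)
      (fun a b hab => by simpa [hT] using hab) (fun n => by simp [IsRoot, h3]))
  refine ⟨p.derivative.eval 0, p.eval 0, eq_affine_of_deriv_eq p.differentiable fun z => ?_⟩
  rw [Polynomial.deriv, sub_eq_zero.1 h4]
  simp

open Polynomial in
-- Here the integral is `exp p / a` plus a constant, and that constant is omitted.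
theorem range_expIntegral_ne_univ {p : ℂ[X]} {a b : ℂ} (ha : a ≠ 0) (h : ∀ z, p.eval z = a * z + b) :
    Set.range (expIntegral p) ≠ Set.univ := fun hs => by
  have hd : ∀ z, HasDerivAt (fun z => expIntegral p z - Complex.exp (p.eval z) / a) 0 z :=
    fun z => by
      refine ((hasDerivAt_expIntegral p z).sub ((p.hasDerivAt z).cexp.div_const a)).congr_deriv ?_
      have : p.derivative.eval z = a := by
        have e1 := p.hasDerivAt z
        rw [funext h] at e1
        simpa using e1.unique (((hasDerivAt_id z).const_mul a).add_const b)
      rw [this, mul_div_cancel_right₀ _ ha, sub_self]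
  have hc := is_const_of_deriv_eq_zero (fun w => (hd w).differentiableAt) (fun w => (hd w).deriv)
  obtain ⟨z, hz⟩ := hs.symm ▸ Set.mem_univ (expIntegral p 0 - Complex.exp (p.eval 0) / a)
  have := hc z 0
  rw [hz, sub_eq_self] at this
  exact div_ne_zero (Complex.exp_ne_zero _) ha this

open Polynomial in
theorem not_isCompositeEntire_expIntegral {p : ℂ[X]} (hp : ∀ c : ℂ, p ≠ C c)
    (hs : Set.range (expIntegral p) = Set.univ) : ¬ IsCompositeEntire (expIntegral p) := by
  rintro ⟨g, h, hg, hh, hga, hha, hf⟩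
  have hder : ∀ z, Complex.exp (p.eval z) = deriv g (h z) * deriv h z := fun z => by
    have h1 : HasDerivAt (g ∘ h) _ z := (hg (h z)).hasDerivAt.comp z (hh z).hasDerivAt
    rw [← hf] at h1
    exact (hasDerivAt_expIntegral p z).unique h1
  have hg' : ∀ z, deriv g (h z) ≠ 0 := fun z h0 =>
    Complex.exp_ne_zero (p.eval z) (by rw [hder, h0, zero_mul])
  have hh' : ∀ z, deriv h z ≠ 0 := fun z h0 =>
    Complex.exp_ne_zero (p.eval z) (by rw [hder, h0, mul_zero])
  have hgc : ¬ ∀ w, g w = g 0 := fun hc => hg' 0 (by rw [funext hc]; simp)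
  have hhc : ¬ ∀ w, h w = h 0 := fun hc => hh' 0 (by rw [funext hc]; simp)
  obtain ⟨C₀, m, hC₀, hfb⟩ := exists_norm_expIntegral_le p
  obtain ⟨C₁, hC₁, hhb⟩ := comp_inner_norm_le_exp hg hh hgc hhc hC₀ (m := m) (fun z => by
    have := hfb z
    rwa [hf] at this)
  by_cases hsurj : ∀ w, ∃ z, h z = w
  -- The chain rule shows `g' ≠ 0` only on the range of `h`; surjectivity extends this to the plane.
  · obtain ⟨G, hG, hgG⟩ := exists_log_of_entire hg.deriv (fun w => by
      obtain ⟨z, rfl⟩ := hsurj w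
      exact hg' z)
    obtain ⟨q, hq⟩ := exists_polynomial_log hh.deriv hh' (norm_deriv_le_exp hh hC₁ hhb)
    have h1 := eq_const_of_exp_eq_one (F := fun z => p.eval z - (G (h z) + q.eval z))
      (p.differentiable.sub ((hG.comp hh).add q.differentiable)) (fun z => by
        rw [Complex.exp_sub, Complex.exp_add, ← hgG, ← hq, ← hder,
          div_self (Complex.exp_ne_zero _)])
    set c := p.eval 0 - (G (h 0) + q.eval 0)
    have h2 : ∀ z, G (h z) = (p - q - Polynomial.C c).eval z := fun z => by
      simp only [eval_sub, eval_C]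
      linear_combination -(h1 z)
    have hGc : ¬ ∀ w, G w = G 0 := fun hGc =>
      hga (mem_affineAut_of_deriv_eq hg (Complex.exp_ne_zero (G 0)) fun w => by rw [hgG, hGc])
    obtain ⟨C₂, n, hC₂, hb₂⟩ := exists_norm_eval_le (p - q - Polynomial.C c)
    obtain ⟨C₃, k, hb₃⟩ := comp_inner_norm_le_pow hG hh hGc hhc hC₂ (fun z => by
      rw [h2]; exact hb₂ z)
    obtain ⟨P, hP⟩ := exists_polynomial_of_norm_le hh hb₃
    obtain ⟨a, b, ha, hab⟩ := eval_eq_of_derivative_eval_ne_zero (p := P) (fun z h0 => hh' z (by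
      rw [funext hP, Polynomial.deriv, h0]))
    exact hha ⟨a, b, ha, funext fun z => by rw [hP, hab]⟩
  · push Not at hsurj
    obtain ⟨b, hb⟩ := hsurj
    obtain ⟨α, β, hα, hαβ⟩ := eq_add_exp_affine_of_omits hh hh' hC₁ hhb hb
    -- The exponential form of `h` makes `h`, and so the integral, periodic.
    have hT : 2 * Real.pi * Complex.I / α ≠ 0 := div_ne_zero Complex.two_pi_I_ne_zero hα
    set T := 2 * Real.pi * Complex.I / α with hTdef
    have hper : ∀ z, expIntegral p (z + T) = expIntegral p z := fun z => by
      have : h (z + T) = h z := by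
        rw [hαβ, hαβ, show α * (z + T) + β = (α * z + β) + 2 * Real.pi * Complex.I by
          rw [hTdef]; field_simp; ring, Complex.exp_add, Complex.exp_two_pi_mul_I, mul_one]
      rw [hf, Function.comp_apply, Function.comp_apply, this]
    obtain ⟨a, b', hab⟩ := eval_eq_affine_of_exp_periodic (p := p) hT (fun z => by
      have e1 := (hasDerivAt_expIntegral p (z + T)).comp_add_const z T
      rw [funext hper] at e1
      exact e1.unique (hasDerivAt_expIntegral p z))
    have ha : a ≠ 0 := by
      rintro rfl
      exact hp b' (Polynomial.funext fun z => by simp [hab])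
    exact range_expIntegral_ne_univ ha hab hs

/-! ### Factorization through powers, and the main theorem -/

theorem range_exp_affine {α : ℂ} (hα : α ≠ 0) (β : ℂ) {c : ℂ} (hc : c ≠ 0) (a : ℂ) :
    Set.range (fun z => a + c * Complex.exp (α * z + β)) = {a}ᶜ := by
  ext w
  simp only [Set.mem_range, Set.mem_compl_iff, Set.mem_singleton_iff]
  constructor
  · rintro ⟨z, rfl⟩ h
    simp [hc] at h
  · intro hw
    obtain ⟨z, hz⟩ := exists_eq_exp_affine hα β (div_ne_zero (sub_ne_zero.2 hw) hc)
    exact ⟨z, by rw [hz]; field_simp; ring⟩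

theorem hasDerivAt_exp_affine (a c α β z : ℂ) :
    HasDerivAt (fun z => a + c * Complex.exp (α * z + β)) (c * (Complex.exp (α * z + β) * α)) z := by
  have h : HasDerivAt (fun z : ℂ => α * z + β) α z := by
    simpa using ((hasDerivAt_id z).const_mul α).add_const β
  exact (h.cexp.const_mul c).const_add a

theorem isEntireLocalHomeo_exp_affine {α c : ℂ} (hα : α ≠ 0) (hc : c ≠ 0) (a β : ℂ) :
    IsEntireLocalHomeo (fun z => a + c * Complex.exp (α * z + β)) :=
  ⟨fun z => (hasDerivAt_exp_affine a c α β z).differentiableAt, fun z => by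
    rw [(hasDerivAt_exp_affine a c α β z).deriv]
    exact mul_ne_zero hc (mul_ne_zero (Complex.exp_ne_zero _) hα)⟩

theorem range_of_mem_affineAut {f : ℂ → ℂ} (hf : f ∈ affineAut) : Set.range f = Set.univ := by
  obtain ⟨a, b, ha, rfl⟩ := hf
  exact Set.range_eq_univ.2 fun w => ⟨(w - b) / a, by field_simp; ring⟩

theorem autC_subset_affineAut : autC ⊆ affineAut := by
  rintro _ ⟨a, rfl⟩
  exact ⟨1, a, one_ne_zero, by simp⟩

theorem notMem_affineAut_of_range {f : ℂ → ℂ} {a : ℂ} (hf : Set.range f = {a}ᶜ) :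
    f ∉ affineAut := fun h => by
  have h1 : a ∈ Set.range f := by rw [range_of_mem_affineAut h]; trivial
  rw [hf] at h1
  exact h1 rfl

open Polynomial in
theorem isEntireLocalHomeo_expIntegral (p : ℂ[X]) : IsEntireLocalHomeo (expIntegral p) :=
  ⟨fun z => (hasDerivAt_expIntegral p z).differentiableAt, fun z => by
    rw [(hasDerivAt_expIntegral p z).deriv]; exact Complex.exp_ne_zero _⟩

open Polynomial in
theorem expIntegral_notMem_affineAut {p : ℂ[X]} (hp : ∀ c : ℂ, p ≠ C c) :
    expIntegral p ∉ affineAut := by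
  rintro ⟨a, b, ha, hf⟩
  have h1 : ∀ z, Complex.exp (p.eval z) = a := fun z => by
    have h2 := hasDerivAt_expIntegral p z
    rw [hf] at h2
    simpa using h2.unique (((hasDerivAt_id z).const_mul a).add_const b)
  have h3 := eq_const_of_exp_eq_one (F := fun z => p.eval z - p.eval 0)
    (p.differentiable.sub_const _) (fun z => by
      rw [Complex.exp_sub, h1, h1, div_self ha])
  refine hp (p.eval 0) (Polynomial.funext fun z => ?_)
  simpa [sub_eq_zero] using h3 z

/-- Factorizations through a power of an integral that omits a value. -/
theorem expIntegral_eq_pow_comp {p : Polynomial ℂ} {d : ℂ} (hd : ∀ z, expIntegral p z ≠ d) (N : ℕ)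
    (a : ℂ) :
    (∃ L : ℂ → ℂ, IsEntireLocalHomeo L ∧ L ∉ affineAut ∧ Set.range L = {a}ᶜ ∧
        expIntegral p =
          (fun w : ℂ => d + (1 / ((N : ℂ) + 1)) * (w - a) ^ (N + 1)) ∘ L) ∧
      (∃ (L : ℂ → ℂ) (ω : ℂ), ω ≠ 0 ∧ L ∈ elh \ autC ∧ Set.range L = {a}ᶜ ∧
        expIntegral p =
          (fun w : ℂ => d + (ω / ((N : ℂ) + 1)) * (w - a) ^ (N + 1)) ∘ L) := by
  obtain ⟨hf, hf'⟩ := isEntireLocalHomeo_expIntegral p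
  obtain ⟨C, m, hC, hb⟩ := exists_norm_expIntegral_le p
  obtain ⟨γ, β, hγ, hγβ⟩ := eq_add_exp_affine_of_omits hf hf' hC hb hd
  have hN : (N : ℂ) + 1 ≠ 0 := by exact_mod_cast N.succ_ne_zero
  have hα : γ / (N + 1) ≠ 0 := div_ne_zero hγ hN
  constructor
  -- The shift `log (N + 1) / (N + 1)` becomes a factor `N + 1` after the power, cancelling `1 / (N
  -- + 1)`.
  · have hr := range_exp_affine hα ((β + Complex.log (N + 1)) / (N + 1)) one_ne_zero a
    refine ⟨_, isEntireLocalHomeo_exp_affine hα one_ne_zero a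
      ((β + Complex.log (N + 1)) / (N + 1)), notMem_affineAut_of_range hr, hr, ?_⟩
    funext z
    rw [hγβ]
    simp only [Function.comp_apply, one_mul, add_sub_cancel_left]
    rw [← Complex.exp_nat_mul, show ((N + 1 : ℕ) : ℂ) *
      (γ / (N + 1) * z + (β + Complex.log (N + 1)) / (N + 1)) =
        γ * z + β + Complex.log (N + 1) by push_cast; field_simp; ring,
      Complex.exp_add _ (Complex.log _), Complex.exp_log hN]
    field_simp
  -- The function `a + α⁻¹ * exp (α z)` has derivative 1 at 0; `ω` absorbs `exp β` and the
  -- rescaling.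
  · set α := γ / (N + 1) with hαdef
    have hr := range_exp_affine hα 0 (inv_ne_zero hα) a
    refine ⟨_, (N + 1) * α ^ (N + 1) * Complex.exp β, mul_ne_zero (mul_ne_zero hN (pow_ne_zero _ hα))
      (Complex.exp_ne_zero _), ⟨⟨isEntireLocalHomeo_exp_affine hα (inv_ne_zero hα) a 0, ?_⟩,
        fun h => notMem_affineAut_of_range hr (autC_subset_affineAut h)⟩, hr, ?_⟩
    · rw [(hasDerivAt_exp_affine a α⁻¹ α 0 0).deriv]
      simp [hα]
    · funext z
      rw [hγβ]
      simp only [Function.comp_apply, add_zero, add_sub_cancel_left]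
      rw [mul_pow, ← Complex.exp_nat_mul, show ((N + 1 : ℕ) : ℂ) * (α * z) = γ * z by
        rw [hαdef]; push_cast; field_simp, Complex.exp_add, inv_pow]
      have := pow_ne_zero (N + 1) hα
      generalize α ^ (N + 1) = x at this ⊢
      field_simp

/-- The values at `a + 1` and `a - 1` agree, so injectivity fails. -/
theorem sq_notMem_affineAut {d a c : ℂ} : (fun w : ℂ => d + c * (w - a) ^ 2) ∉ affineAut := by
  rintro ⟨s, b, hs, h⟩
  have h1 := congrFun h (a + 1)
  have h2 := congrFun h (a - 1)
  refine hs ?_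
  linear_combination (h2 - h1) / 2

theorem theorem7 (p : Polynomial ℂ) (hp : ∀ c : ℂ, p ≠ Polynomial.C c) :
    -- `f` is entire with non-vanishing derivative and is not an automorphism of `ℂ`
    (IsEntireLocalHomeo (expIntegral p) ∧ expIntegral p ∉ affineAut) ∧
    -- and lies in `elh(ℂ) \ Aut(ℂ)` when it has the normalization `f'(0) = 1`
    (Complex.exp (p.eval 0) = 1 → expIntegral p ∈ elh \ autC) ∧
    -- primeness
    (IsPrimeEntire (expIntegral p) ↔ Set.range (expIntegral p) = Set.univ) ∧
    -- the factorization through a root of `f - d` when `f` omits the value `d`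
    (∀ d : ℂ, (∀ z, expIntegral p z ≠ d) → ∀ N : ℕ, 1 ≤ N → ∀ a : ℂ,
      (∃ L : ℂ → ℂ, IsEntireLocalHomeo L ∧ L ∉ affineAut ∧ Set.range L = {a}ᶜ ∧
        expIntegral p =
          (fun w : ℂ => d + (1 / ((N : ℂ) + 1)) * (w - a) ^ (N + 1)) ∘ L) ∧
      (∃ (L : ℂ → ℂ) (ω : ℂ), ω ≠ 0 ∧ L ∈ elh \ autC ∧ Set.range L = {a}ᶜ ∧
        expIntegral p =
          (fun w : ℂ => d + (ω / ((N : ℂ) + 1)) * (w - a) ^ (N + 1)) ∘ L)) := by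
  refine ⟨⟨isEntireLocalHomeo_expIntegral p, expIntegral_notMem_affineAut hp⟩,
    fun h0 => ⟨⟨isEntireLocalHomeo_expIntegral p, ?_⟩,
      fun h => expIntegral_notMem_affineAut hp (autC_subset_affineAut h)⟩,
    ⟨fun ⟨_, hprime⟩ => ?_, fun hs => ⟨isEntireLocalHomeo_expIntegral p,
      not_isCompositeEntire_expIntegral hp hs⟩⟩,
    fun d hd N _ a => expIntegral_eq_pow_comp hd N a⟩
  · rw [(hasDerivAt_expIntegral p 0).deriv, h0]
  · by_contra hne
    obtain ⟨d, hd⟩ := (Set.ne_univ_iff_exists_notMem _).1 hne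
    -- `N = 1` already suffices: the outer factor is then quadratic.
    obtain ⟨⟨L, hL, hLa, -, hLf⟩, -⟩ :=
      expIntegral_eq_pow_comp (fun z hz => hd ⟨z, hz⟩) 1 0
    exact hprime ⟨_, L, by fun_prop, hL.1, sq_notMem_affineAut, hLa, hLf⟩
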